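/- Let $d_A,d_B$ be positive integers, $D=d_Ad_B$, $\mathcal H_A=\mathbb C^{d_A}$, $\mathcal H_B=\mathbb C^{d_B}$. For an operator $X$ write $\|X\|_1=\operatorname{tr}\sqrt{X^\dagger X}$ and $\|X\|_2=\sqrt{\operatorname{tr}(X^\dagger X)}$. A POVM on $\mathcal H$ in density form consists of a $\sigma$-finite measure $\mu$ and positive semidefinite operators $M(x)$ with $\int M(x)\,\mu(dx)=\mathbf 1$; it defines $\|\xi\|_{M}=\int|\operatorname{tr}(\xi M(x))|\,\mu(dx)$, and $\lambda(M)$ denotes the largest real number $l$ such that $l\,\|\xi\|_1\le\|\xi\|_{M}$ for all traceless Hermitian operators $\xi$ on $\mathcal H$. (This number is well defined as soon as $\dim\mathcal H\ge 2$.) The isotropic POVM $\mathcal U$ on $\mathbb C^d$ is $\bigl(d\,|\psi\rangle\langle\psi|\,d\psi\bigr)$, where $d\psi$ is the normalised uniform (unitarily invariant) distribution on unit vectors. Let $\mathcal U_A,\mathcal U_B$ be the isotropic POVMs on $\mathcal H_A,\mathcal H_B$, and let $\mathcal U_A\otimes\mathcal U_B$ be the POVM $\bigl(D\,|\varphi\rangle\langle\varphi|\otimes|\psi\rangle\langle\psi|\,d\varphi\,d\psi\bigr)$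 on $\mathcal H_A\otimes\mathcal H_B$. Theorem. For any two states (density operators) $\rho,\sigma$ on $\mathcal H_A\otimes\mathcal H_B$, the operator $\xi=\rho-\sigma$ satisfies $$\|\xi\|_{\mathcal U_A\otimes\mathcal U_B}\;\ge\;\frac1{\sqrt{153}}\,\|\xi\|_2\;\ge\;\frac1{\sqrt{153\,D}}\,\|\xi\|_1 .$$ Consequently, if $D\ge2$, then $$\lambda(\mathcal U_A\otimes\mathcal U_B)\;\ge\;\frac1{\sqrt{153\,D}} .$$ -/

import Mathlib

open MeasureTheory Matrix
open scoped Pointwise Kronecker ComplexOrder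

noncomputable section

namespace QMeas

/-! ### States and norms of operators on `ℂⁿ` -/

section Operators

variable {n : Type*} [Fintype n] [DecidableEq n]

/-- Density operators: positive semidefinite operators of trace one. -/
def IsState (ρ : Matrix n n ℂ) : Prop := ρ.PosSemidef ∧ ρ.trace = 1

/-- The trace norm `‖X‖₁ = tr √(X† X)`. -/
def traceNorm (X : Matrix n n ℂ) : ℝ := (cfc Real.sqrt (Xᴴ * X)).trace.re

/-- The Hilbert-Schmidt norm `‖X‖₂ = √(tr (X† X))`. -/
def hsNorm (X : Matrix n n ℂ) : ℝ := √((Xᴴ * X).trace.re)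

end Operators

/-! ### POVMs given by a density with respect to a reference measure -/

/-- A POVM on `ℂⁿ` with outcomes in `Ω`, in density form `M(x) μ(dx)`: the operators `M(x)` are
positive semidefinite and `∫ M(x) μ(dx) = 1`. A discrete POVM `(M_k)` is the case in which `μ` is
the counting measure of a countable set. -/
structure POVM (Ω : Type*) [MeasurableSpace Ω] (n : Type*) [Fintype n] [DecidableEq n] where
  /-- the reference measure on the outcomes -/
  base : Measure Ω
  sigmaFinite : SigmaFinite base
  /-- the operator density of the POVM -/
  effect : Ω → Matrix n n ℂ
  posSemidef : ∀ x, (effect x).PosSemidef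
  integrable : ∀ i j, Integrable (fun x => effect x i j) base
  integral_eq : ∀ i j, ∫ x, effect x i j ∂base = (1 : Matrix n n ℂ) i j

namespace POVM

variable {Ω Ω' : Type*} [MeasurableSpace Ω] [MeasurableSpace Ω']
  {n m : Type*} [Fintype n] [DecidableEq n] [Fintype m] [DecidableEq m]

/-- The measurement map `ξ ↦ (x ↦ tr (ξ M(x)))`: the density of the outcome distribution with
respect to the reference measure. -/
def output (M : POVM Ω n) (ξ : Matrix n n ℂ) (x : Ω) : ℂ := (ξ * M.effect x).trace

/-- The norm `‖ξ‖_M = ∫ |tr (ξ M(x))| μ(dx)`, the `L¹`-norm of the outcome distribution. -/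
def norm (M : POVM Ω n) (ξ : Matrix n n ℂ) : ℝ := ∫ x, ‖M.output ξ x‖ ∂M.base

/-- The numbers `l` with `l ‖ξ‖₁ ≤ ‖ξ‖_M` for all traceless Hermitian `ξ`. -/
def dominationSet (M : POVM Ω n) : Set ℝ :=
  {l | ∀ ξ : Matrix n n ℂ, ξ.IsHermitian → ξ.trace = 0 → l * traceNorm ξ ≤ M.norm ξ}

/-- The constant of domination `λ(M)`: the largest `l` with `l ‖ξ‖₁ ≤ ‖ξ‖_M` for all traceless
Hermitian `ξ`. -/
def domination (M : POVM Ω n) : ℝ := sSup M.dominationSet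

/-- The tensor product of two POVMs: outcomes are pairs and the effects are `M(x) ⊗ N(y)`. -/
def tensor (M : POVM Ω n) (N : POVM Ω' m) : POVM (Ω × Ω') (n × m) where
  base := M.base.prod N.base
  sigmaFinite := by
    have := M.sigmaFinite
    have := N.sigmaFinite
    infer_instance
  effect z := M.effect z.1 ⊗ₖ N.effect z.2
  posSemidef z := (M.posSemidef z.1).kronecker (N.posSemidef z.2)
  integrable i j := by
    have := M.sigmaFinite
    have := N.sigmaFinite
    exact (M.integrable i.1 j.1).mul_prod (N.integrable i.2 j.2)
  integral_eq i j := by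
    have := M.sigmaFinite
    have := N.sigmaFinite
    have h := integral_prod_mul (μ := M.base) (ν := N.base)
      (fun x => M.effect x i.1 j.1) (fun y => N.effect y i.2 j.2)
    rw [M.integral_eq, N.integral_eq] at h
    simp only [kroneckerMap_apply]
    rw [h, ← one_kronecker_one, kroneckerMap_apply]

end POVM

/-! ### The isotropic POVM -/

section Isotropic

variable (n : Type*) [Fintype n]

/-- The set of unit vectors of `ℂⁿ`. -/
abbrev UnitVectors : Type _ := Metric.sphere (0 : EuclideanSpace ℂ n) 1

/-- The normalised uniform (unitarily invariant) distribution on the unit vectors of `ℂⁿ`: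
the normalised surface measure of the unit sphere. -/
def uniformMeasure : Measure (UnitVectors n) :=
  ((volume : Measure (EuclideanSpace ℂ n)).toSphere Set.univ)⁻¹ •
    (volume : Measure (EuclideanSpace ℂ n)).toSphere

/-- The projector `|ψ⟩⟨ψ|`. -/
def projector (ψ : UnitVectors n) : Matrix n n ℂ :=
  vecMulVec (ψ : EuclideanSpace ℂ n).ofLp (star (ψ : EuclideanSpace ℂ n).ofLp)

variable {n}

theorem uniformMeasure_univ [Nonempty n] : uniformMeasure n Set.univ = 1 := by
  rw [uniformMeasure, Measure.smul_apply, smul_eq_mul, ENNReal.inv_mul_cancel]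
  · simp [-Measure.toSphere_apply_univ]
  · exact measure_ne_top _ _

instance : IsFiniteMeasure (uniformMeasure n) := by
  rcases isEmpty_or_nonempty n with h | h
  · constructor
    have : Subsingleton (EuclideanSpace ℂ n) := inferInstance
    have h0 : (volume : Measure (EuclideanSpace ℂ n)).toSphere = 0 :=
      (Measure.toSphere_eq_zero_iff _).2 this
    simp [uniformMeasure, h0]
  · constructor
    rw [uniformMeasure_univ]
    exact ENNReal.one_lt_top

/-- The action of a linear isometry on unit vectors. -/
def sphereMap (e : EuclideanSpace ℂ n ≃ₗᵢ[ℝ] EuclideanSpace ℂ n) (ψ : UnitVectors n) :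
    UnitVectors n :=
  ⟨e ψ, by simp⟩

theorem measurePreserving_sphereMap (e : EuclideanSpace ℂ n ≃ₗᵢ[ℝ] EuclideanSpace ℂ n) :
    MeasurePreserving (sphereMap e) (uniformMeasure n) (uniformMeasure n) := by
  have hc : Continuous (sphereMap e) :=
    (e.continuous.comp continuous_subtype_val).subtype_mk _
  refine MeasurePreserving.smul_measure ⟨hc.measurable, ?_⟩ _
  ext s hs
  rw [Measure.map_apply hc.measurable hs, Measure.toSphere_apply' _ (hc.measurable hs),
    Measure.toSphere_apply' _ hs]
  congr 1
  have hset : Set.Ioo (0 : ℝ) 1 • ((↑) '' (sphereMap e ⁻¹' s) : Set (EuclideanSpace ℂ n)) =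
      e ⁻¹' (Set.Ioo (0 : ℝ) 1 • ((↑) '' s)) := by
    ext v
    simp only [Set.mem_smul, Set.mem_image, Set.mem_preimage]
    constructor
    · rintro ⟨r, hr, _, ⟨ψ, hψ, rfl⟩, rfl⟩
      exact ⟨r, hr, _, ⟨_, hψ, rfl⟩, by simp [sphereMap]⟩
    · rintro ⟨r, hr, _, ⟨ψ, hψ, rfl⟩, h⟩
      refine ⟨r, hr, _, ⟨sphereMap e.symm ψ, ?_, rfl⟩, ?_⟩
      · have : sphereMap e (sphereMap e.symm ψ) = ψ := Subtype.ext (by simp [sphereMap])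
        rwa [this]
      · apply e.injective
        rw [← h]
        simp [sphereMap]
  rw [hset]
  exact e.measurePreserving.measure_preimage_equiv (f := e.toHomeomorph.toMeasurableEquiv) _

theorem continuous_coord (i j : n) :
    Continuous fun ψ : UnitVectors n => projector n ψ i j := by
  simp only [projector, vecMulVec_apply, Pi.star_apply]
  fun_prop

theorem integrable_projector (i j : n) :
    Integrable (fun ψ => projector n ψ i j) (uniformMeasure n) := by
  have : CompactSpace (UnitVectors n) := inferInstance
  exact (continuous_coord i j).integrable_of_hasCompactSupport
    (HasCompactSupport.of_compactSpace _)

theorem integral_comp_sphereMap (e : EuclideanSpace ℂ n ≃ₗᵢ[ℝ] EuclideanSpace ℂ n) (i j : n) :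
    ∫ ψ, projector n (sphereMap e ψ) i j ∂uniformMeasure n =
      ∫ ψ, projector n ψ i j ∂uniformMeasure n := by
  have h := measurePreserving_sphereMap e
  conv_rhs => rw [← h.map_eq]
  rw [integral_map h.aemeasurable (continuous_coord i j).aestronglyMeasurable]

theorem integral_projector_of_ne [DecidableEq n] {i j : n} (hij : i ≠ j) :
    ∫ ψ, projector n ψ i j ∂uniformMeasure n = 0 := by
  have h := integral_comp_sphereMap (n := n)
    (LinearIsometryEquiv.piLpCongrRight 2 fun k =>
      if k = i then LinearIsometryEquiv.neg ℝ else LinearIsometryEquiv.refl ℝ ℂ) i j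
  have h2 : ∀ ψ : UnitVectors n, projector n (sphereMap
      (LinearIsometryEquiv.piLpCongrRight 2 fun k =>
        if k = i then LinearIsometryEquiv.neg ℝ else LinearIsometryEquiv.refl ℝ ℂ) ψ) i j =
      -projector n ψ i j := by
    intro ψ
    simp [projector, sphereMap, vecMulVec_apply, hij.symm]
  simp only [h2, integral_neg] at h
  exact self_eq_neg.1 h.symm

theorem integral_projector_diag [DecidableEq n] (i j : n) :
    ∫ ψ, projector n ψ i i ∂uniformMeasure n = ∫ ψ, projector n ψ j j ∂uniformMeasure n := by
  rw [← integral_comp_sphereMap (LinearIsometryEquiv.piLpCongrLeft 2 ℝ ℂ (Equiv.swap i j)) i i]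
  congr 1
  ext ψ
  simp [projector, sphereMap, vecMulVec_apply]

theorem trace_projector (ψ : UnitVectors n) : ∑ i, projector n ψ i i = 1 := by
  have h : ‖(ψ : EuclideanSpace ℂ n)‖ = 1 := by simp
  have h2 := EuclideanSpace.norm_sq_eq (ψ : EuclideanSpace ℂ n)
  rw [h, one_pow] at h2
  simp only [projector, vecMulVec_apply, Pi.star_apply, Complex.star_def, Complex.mul_conj']
  exact_mod_cast h2.symm

theorem integral_projector [DecidableEq n] (i j : n) :
    ∫ ψ, (Fintype.card n : ℂ) * projector n ψ i j ∂uniformMeasure n =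
      (1 : Matrix n n ℂ) i j := by
  rw [integral_const_mul]
  by_cases hij : i = j
  · subst hij
    have : Nonempty n := ⟨i⟩
    have h : ∑ k, ∫ ψ, projector n ψ k k ∂uniformMeasure n = 1 := by
      rw [← integral_finsetSum _ fun k _ => integrable_projector k k]
      simp [trace_projector, measureReal_def, uniformMeasure_univ]
    rw [Finset.sum_congr rfl fun k _ => integral_projector_diag k i] at h
    simpa using h
  · simp [integral_projector_of_ne hij, hij]

variable (n)

/-- The isotropic POVM `d |ψ⟩⟨ψ| dψ` on `ℂⁿ`, where `d = |n|` is the dimension. -/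
def isotropicPOVM [DecidableEq n] : POVM (UnitVectors n) n where
  base := uniformMeasure n
  sigmaFinite := inferInstance
  effect ψ := (Fintype.card n : ℂ) • projector n ψ
  posSemidef ψ := (posSemidef_vecMulVec_self_star _).smul (Nat.cast_nonneg _)
  integrable i j := by
    simpa using (integrable_projector i j).const_mul (Fintype.card n : ℂ)
  integral_eq i j := by simpa using integral_projector i j

end Isotropic

end QMeas

end

/-! The method is the fourth moment method. Put f(φ,ψ) = |tr ξ(φ⊗ψ)| for Hermitian ξ and let L, S, F
be its first, second and fourth moments under the product of the uniform measures. Then ‖ξ‖ for the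
tensor POVM is D·L, and the Hölder-type inequality S³ ≤ L² F (`integral_sq_pow_three_le`) bounds L
from below once S is bounded below and F above.

On one system of dimension d, a Hermitian form is diagonal in suitable coordinates, with real
coefficients c. Its moments on the sphere come from a Gaussian vector: the |zᵢ|² are independent
exponential variables, and the integral of a homogeneous function splits into a spherical and a
radial factor. The second moment is (p₁² + p₂)/(d(d+1)), with pₖ the power sums of c. The fourth has
denominator d(d+1)(d+2)(d+3) and a numerator at most 12(p₁² + p₂)². Hence fourth moment ≤ K·(second
moment)² with K = 12·d(d+1)/((d+2)(d+3)).

For two systems, such constants multiply by Minkowski's inequality (`integral_prod_sq_le`), so F ≤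
K_A K_B S². Computing the second moment in each factor and dropping the nonnegative trace terms
gives ‖ξ‖₂² ≤ d_A(d_A+1) d_B(d_B+1) S. Together S ≤ K_A K_B L², and the dimension factors combine to
at most D², so ‖ξ‖₂ ≤ 12·D·L. This is enough because 144 ≤ 153. The trace norm enters only through
‖ξ‖₁ ≤ √D ‖ξ‖₂. -/

noncomputable section

namespace QMeas

open ProbabilityTheory

section

/-! ### The standard complex Gaussian measure -/

/-- The density `e^{-|z|²} / π` of the standard complex Gaussian. -/
def gaussianDensity (z : ℂ) : ℝ := Real.exp (-‖z‖ ^ 2) / Real.pi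

/-- The standard complex Gaussian measure. -/
def complexGaussian : Measure ℂ := volume.withDensity fun z => ENNReal.ofReal (gaussianDensity z)

theorem gaussianDensity_pos (z : ℂ) : 0 < gaussianDensity z := by
  unfold gaussianDensity; positivity

theorem continuous_gaussianDensity : Continuous gaussianDensity := by
  unfold gaussianDensity; fun_prop

/-- In polar coordinates this is a Gamma integral: |z|² is an exponential variable of mean one. -/
theorem integral_normSq_pow_mul_gaussianDensity (k : ℕ) :
    ∫ z : ℂ, (‖z‖ ^ 2) ^ k * gaussianDensity z = k.factorial := by
  have h := Complex.integral_rpow_mul_exp_neg_rpow (p := 2) (q := 2 * k) (by norm_num)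
    (by have : (0 : ℝ) ≤ k := by positivity
        linarith)
  have h2 : ((2 * k + 2 : ℝ) / 2) = k + 1 := by ring
  rw [h2, Real.Gamma_nat_eq_factorial] at h
  have h3 : ∀ z : ℂ, (‖z‖ ^ 2) ^ k * gaussianDensity z =
      Real.pi⁻¹ * (‖z‖ ^ (2 * (k : ℝ)) * Real.exp (-‖z‖ ^ (2 : ℝ))) := by
    intro z
    have : (2 * (k : ℝ)) = ((2 * k : ℕ) : ℝ) := by push_cast; ring
    rw [this, Real.rpow_natCast, pow_mul, Real.rpow_ofNat, gaussianDensity]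
    ring
  simp_rw [h3]
  rw [integral_const_mul, h]
  field_simp

theorem integrable_normSq_pow_mul_gaussianDensity (k : ℕ) :
    Integrable fun z : ℂ => (‖z‖ ^ 2) ^ k * gaussianDensity z := by
  -- A non-integrable function would have integral 0 by convention, but the value found is k! ≠ 0.
  by_contra h
  have h2 := integral_normSq_pow_mul_gaussianDensity k
  rw [integral_undef h] at h2
  exact (Nat.cast_ne_zero.2 k.factorial_ne_zero) h2.symm

theorem integrable_gaussianDensity : Integrable gaussianDensity := by
  simpa using integrable_normSq_pow_mul_gaussianDensity 0

theorem integral_complexGaussian (f : ℂ → ℝ) :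
    ∫ z, f z ∂complexGaussian = ∫ z, f z * gaussianDensity z := by
  rw [complexGaussian, integral_withDensity_eq_integral_toReal_smul
    (by have := continuous_gaussianDensity; fun_prop) (by simp)]
  refine integral_congr_ae (.of_forall fun z => ?_)
  simp [ENNReal.toReal_ofReal (gaussianDensity_pos z).le, mul_comm]

theorem integral_normSq_pow (k : ℕ) :
    ∫ z, (‖z‖ ^ 2) ^ k ∂complexGaussian = k.factorial := by
  rw [integral_complexGaussian, integral_normSq_pow_mul_gaussianDensity]

instance : IsProbabilityMeasure complexGaussian := by
  constructor
  rw [complexGaussian, withDensity_apply _ MeasurableSet.univ, setLIntegral_univ,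
    ← ofReal_integral_eq_lintegral_ofReal integrable_gaussianDensity
      (.of_forall fun z => (gaussianDensity_pos z).le)]
  simpa using integral_normSq_pow_mul_gaussianDensity 0

theorem integrable_normSq_pow (k : ℕ) :
    Integrable (fun z : ℂ => (‖z‖ ^ 2) ^ k) complexGaussian := by
  by_contra h
  have h2 := integral_normSq_pow k
  rw [integral_undef h] at h2
  exact (Nat.cast_ne_zero.2 k.factorial_ne_zero) h2.symm

variable (n : Type*) [Fintype n]

/-- The standard Gaussian measure on `ℂⁿ`. -/
def gaussianPi : Measure (n → ℂ) := Measure.pi fun _ => complexGaussian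

instance : IsProbabilityMeasure (gaussianPi n) := by
  unfold gaussianPi; infer_instance

/-- Independence of coordinates is visible in the product form, rotational symmetry in the density
form; both are needed. -/
theorem gaussianPi_eq_withDensity : gaussianPi n =
    (volume : Measure (n → ℂ)).withDensity fun z => ENNReal.ofReal (∏ i, gaussianDensity (z i)) := by
  refine Measure.pi_eq fun s hs => ?_
  have hI : Integrable (fun z : n → ℂ => ∏ i, gaussianDensity (z i))
      (Measure.pi fun i => (volume : Measure ℂ).restrict (s i)) :=
    Integrable.fintype_prod (f := fun _ => gaussianDensity)
      fun i => integrable_gaussianDensity.restrict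
  rw [withDensity_apply _ (MeasurableSet.univ_pi hs), volume_pi, Measure.restrict_pi_pi,
    ← ofReal_integral_eq_lintegral_ofReal hI
      (.of_forall fun z => Finset.prod_nonneg fun i _ => (gaussianDensity_pos _).le),
    integral_fintype_prod_eq_prod (fun _ => gaussianDensity),
    ENNReal.ofReal_prod_of_nonneg fun i _ =>
      integral_nonneg fun z => (gaussianDensity_pos _).le]
  refine Finset.prod_congr rfl fun i _ => ?_
  rw [complexGaussian, withDensity_apply _ (hs i),
    ofReal_integral_eq_lintegral_ofReal integrable_gaussianDensity.restrict
      (.of_forall fun z => (gaussianDensity_pos _).le)]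

variable {n}

theorem integral_gaussianPi (f : (n → ℂ) → ℝ) :
    ∫ z, f z ∂gaussianPi n = ∫ z, f z * ∏ i, gaussianDensity (z i) := by
  have hc := continuous_gaussianDensity
  rw [gaussianPi_eq_withDensity, integral_withDensity_eq_integral_toReal_smul
    (by fun_prop) (by simp)]
  refine integral_congr_ae (.of_forall fun z => ?_)
  simp [ENNReal.toReal_ofReal (Finset.prod_nonneg fun i _ => (gaussianDensity_pos (z i)).le),
    mul_comm]

/-! ### Moments of Gaussian quadratic forms -/

theorem iIndepFun_normSq : iIndepFun (fun (i : n) (z : n → ℂ) => ‖z i‖ ^ 2) (gaussianPi n) :=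
  iIndepFun_pi (X := fun _ z => ‖z‖ ^ 2) fun i => by fun_prop

theorem integral_gaussianPi_normSq_pow (i : n) (k : ℕ) :
    ∫ z, (‖z i‖ ^ 2) ^ k ∂gaussianPi n = k.factorial := by
  rw [← integral_normSq_pow k]
  exact integral_comp_eval (μ := fun _ : n => complexGaussian) (i := i)
    (f := fun z : ℂ => (‖z‖ ^ 2) ^ k) (by fun_prop)

theorem integrable_gaussianPi_normSq_pow (i : n) (k : ℕ) :
    Integrable (fun z : n → ℂ => (‖z i‖ ^ 2) ^ k) (gaussianPi n) :=
  integrable_comp_eval (μ := fun _ : n => complexGaussian) (i := i)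
    (f := fun z : ℂ => (‖z‖ ^ 2) ^ k) (integrable_normSq_pow k)

theorem integral_add_pow_of_indepFun {Ω : Type*} [MeasurableSpace Ω] {μ : Measure Ω}
    [IsProbabilityMeasure μ] {X Y : Ω → ℝ} (h : IndepFun X Y μ)
    (hXi : ∀ k : ℕ, Integrable (fun ω => X ω ^ k) μ) (hYi : ∀ k : ℕ, Integrable (fun ω => Y ω ^ k) μ)
    (k : ℕ) :
    Integrable (fun ω => (X ω + Y ω) ^ k) μ ∧
    ∫ ω, (X ω + Y ω) ^ k ∂μ = ∑ m ∈ Finset.range (k + 1),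
      (∫ ω, X ω ^ m ∂μ) * (∫ ω, Y ω ^ (k - m) ∂μ) * (k.choose m) := by
  have hind : ∀ i j : ℕ, IndepFun (fun ω => X ω ^ i) (fun ω => Y ω ^ j) μ := fun i j =>
    h.comp (φ := fun x => x ^ i) (ψ := fun x => x ^ j) (by fun_prop) (by fun_prop)
  have hint : ∀ i j : ℕ, Integrable (fun ω => X ω ^ i * Y ω ^ j) μ := fun i j =>
    (hind i j).integrable_mul (hXi i) (hYi j)
  simp_rw [add_pow]
  refine ⟨integrable_finsetSum _ fun m _ => (hint _ _).mul_const _, ?_⟩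
  rw [integral_finsetSum _ fun m _ => (hint _ _).mul_const _]
  refine Finset.sum_congr rfl fun m _ => ?_
  rw [integral_mul_const, (hind _ _).integral_fun_mul_eq_mul_integral
    (hXi _).aestronglyMeasurable (hYi _).aestronglyMeasurable]

/-- The moments up to order four of `∑ cᵢ |zᵢ|²` in terms of the power sums of `c`. -/
theorem gaussianPi_moments (c : n → ℝ) (s : Finset n) :
    (∀ k : ℕ, Integrable (fun z : n → ℂ => (∑ i ∈ s, c i * ‖z i‖ ^ 2) ^ k) (gaussianPi n)) ∧
    ∫ z, (∑ i ∈ s, c i * ‖z i‖ ^ 2) ∂gaussianPi n = ∑ i ∈ s, c i ∧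
    ∫ z, (∑ i ∈ s, c i * ‖z i‖ ^ 2) ^ 2 ∂gaussianPi n = (∑ i ∈ s, c i) ^ 2 + ∑ i ∈ s, c i ^ 2 ∧
    ∫ z, (∑ i ∈ s, c i * ‖z i‖ ^ 2) ^ 3 ∂gaussianPi n =
      (∑ i ∈ s, c i) ^ 3 + 3 * (∑ i ∈ s, c i) * (∑ i ∈ s, c i ^ 2) + 2 * ∑ i ∈ s, c i ^ 3 ∧
    ∫ z, (∑ i ∈ s, c i * ‖z i‖ ^ 2) ^ 4 ∂gaussianPi n =
      (∑ i ∈ s, c i) ^ 4 + 6 * (∑ i ∈ s, c i) ^ 2 * (∑ i ∈ s, c i ^ 2) +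
      3 * (∑ i ∈ s, c i ^ 2) ^ 2 + 8 * (∑ i ∈ s, c i) * (∑ i ∈ s, c i ^ 3) +
      6 * ∑ i ∈ s, c i ^ 4 := by
  classical
  induction s using Finset.induction_on with
  | empty => simp
  | insert i s hi ih =>
    obtain ⟨ih0, ih1, ih2, ih3, ih4⟩ := ih
    -- The new term involves a coordinate outside `s`, so it is independent of the partial sum and
    -- the binomial expansion factorises.
    have hind : IndepFun (fun z : n → ℂ => ∑ i ∈ s, c i * ‖z i‖ ^ 2)
        (fun z => c i * ‖z i‖ ^ 2) (gaussianPi n) := by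
      have h := (iIndepFun_normSq (n := n)).comp (fun i x => c i * x) fun i => by fun_prop
      have h2 := h.indepFun_finsetSum_of_notMem (fun i => by fun_prop) hi
      convert h2 using 1
      · ext z
        simp
      · rfl
    have hYi : ∀ k : ℕ, Integrable (fun z : n → ℂ => (c i * ‖z i‖ ^ 2) ^ k) (gaussianPi n) := by
      intro k
      simp_rw [mul_pow]
      simpa using (integrable_gaussianPi_normSq_pow i k).const_mul (c i ^ k)
    have hY : ∀ k : ℕ, ∫ z, (c i * ‖z i‖ ^ 2) ^ k ∂gaussianPi n = c i ^ k * k.factorial := by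
      intro k
      simp_rw [mul_pow _ _ k]
      rw [integral_const_mul, integral_gaussianPi_normSq_pow]
    have key := integral_add_pow_of_indepFun hind ih0 hYi
    have hswap : ∀ z : n → ℂ, ∑ j ∈ insert i s, c j * ‖z j‖ ^ 2 =
        ∑ j ∈ s, c j * ‖z j‖ ^ 2 + c i * ‖z i‖ ^ 2 := fun z => by
      rw [Finset.sum_insert hi, add_comm]
    simp_rw [hswap, Finset.sum_insert hi]
    have k1 := (key 1).2
    have k2 := (key 2).2
    have k3 := (key 3).2
    have k4 := (key 4).2
    simp only [Finset.sum_range_succ, Finset.sum_range_zero, hY, pow_one, pow_zero, ih1, ih2, ih3,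
      ih4, integral_const, probReal_univ] at k1 k2 k3 k4
    norm_num [Nat.factorial, Nat.choose] at k1 k2 k3 k4
    refine ⟨fun k => (key k).1, ?_, ?_, ?_, ?_⟩
    · rw [k1]
    · rw [k2]; ring
    · rw [k3]; ring
    · rw [k4]; ring

end

section

/-! ### Polar coordinates -/

/-- The radial factor depends on `g` only through its degree `m`, so it cancels when two functions
of equal degree are compared. -/
theorem integral_homogeneous_mul_radial {E : Type*} [NormedAddCommGroup E] [NormedSpace ℝ E]
    [FiniteDimensional ℝ E] [MeasurableSpace E] [BorelSpace E] [Nontrivial E] (μ : Measure E)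
    [μ.IsAddHaarMeasure] {g : E → ℝ} {m : ℕ} (hg : ∀ r : ℝ, 0 < r → ∀ x, g (r • x) = r ^ m * g x)
    (w : ℝ → ℝ) :
    ∫ x, g x * w ‖x‖ ∂μ = (∫ ψ : Metric.sphere (0 : E) 1, g ψ ∂μ.toSphere) *
      ∫ r : Set.Ioi (0 : ℝ), (r : ℝ) ^ m * w r
        ∂Measure.volumeIoiPow (Module.finrank ℝ E - 1) := by
  rw [← integral_prod_mul]
  calc ∫ x, g x * w ‖x‖ ∂μ
      = ∫ x : ({(0)}ᶜ : Set E), g x * w ‖x.1‖ ∂(μ.comap (↑)) := by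
        rw [integral_subtype_comap (measurableSet_singleton _).compl fun x ↦ g x * w ‖x‖,
          restrict_compl_singleton]
    _ = _ := by
        rw [← μ.measurePreserving_homeomorphUnitSphereProd.integral_comp
          (Homeomorph.measurableEmbedding _)]
        refine integral_congr_ae (.of_forall fun x => ?_)
        have hx : 0 < ‖x.1‖ := norm_pos_iff.2 x.2
        simp only [homeomorphUnitSphereProd_apply_fst_coe, homeomorphUnitSphereProd_apply_snd_coe]
        rw [hg _ (inv_pos.2 hx), inv_pow]
        field_simp

variable {n : Type*} [Fintype n]

/-- Haar measures on a finite-dimensional space are proportional. The value of the constant is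
irrelevant, since it cancels in `integral_gaussianPi_homogeneous`. -/
theorem exists_integral_toLp_eq (n : Type*) [Fintype n] :
    ∃ c : ℝ, c ≠ 0 ∧ ∀ f : EuclideanSpace ℂ n → ℝ,
      ∫ z : n → ℂ, f (WithLp.toLp 2 z) = c * ∫ x, f x := by
  let e := (PiLp.continuousLinearEquiv 2 ℝ fun _ : n => ℂ).symm
  have h : ((volume : Measure (n → ℂ)).map e).IsAddHaarMeasure := inferInstance
  have h2 := Measure.isAddLeftInvariant_eq_smul ((volume : Measure (n → ℂ)).map e)
    (volume : Measure (EuclideanSpace ℂ n))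
  set k := ((volume : Measure (n → ℂ)).map e).addHaarScalarFactor
    (volume : Measure (EuclideanSpace ℂ n)) with hk
  refine ⟨k, ?_, fun f => ?_⟩
  · exact_mod_cast (Measure.addHaarScalarFactor_pos_of_isAddHaarMeasure _ _).ne'
  · have h3 : ∫ x, f x ∂(volume : Measure (n → ℂ)).map e = ∫ z : n → ℂ, f (e z) :=
      e.toHomeomorph.measurableEmbedding.integral_map f
    rw [h2, integral_smul_nnreal_measure] at h3
    exact h3.symm

theorem integral_uniformMeasure (g : UnitVectors n → ℝ) :
    ∫ ψ, g ψ ∂uniformMeasure n =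
      ((volume : Measure (EuclideanSpace ℂ n)).toSphere.real Set.univ)⁻¹ *
        ∫ ψ, g ψ ∂(volume : Measure (EuclideanSpace ℂ n)).toSphere := by
  rw [uniformMeasure, integral_smul_measure, ENNReal.toReal_inv, smul_eq_mul]
  rfl

theorem prod_gaussianDensity (z : n → ℂ) : ∏ i, gaussianDensity (z i) =
    Real.exp (-‖(WithLp.toLp 2 z : EuclideanSpace ℂ n)‖ ^ 2) / Real.pi ^ Fintype.card n := by
  simp [gaussianDensity, Finset.prod_div_distrib, ← Real.exp_sum, EuclideanSpace.norm_sq_eq]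

/-- Compare `g` with ‖x‖^m, which has the same degree and equals 1 on the sphere. -/
theorem integral_gaussianPi_homogeneous [Nonempty n] {g : EuclideanSpace ℂ n → ℝ} {m : ℕ}
    (hg : ∀ r : ℝ, 0 < r → ∀ x, g (r • x) = r ^ m * g x) :
    ∫ z, g (WithLp.toLp 2 z) ∂gaussianPi n = (∫ ψ : UnitVectors n, g ψ ∂uniformMeasure n) *
      ∫ z, ‖(WithLp.toLp 2 z : EuclideanSpace ℂ n)‖ ^ m ∂gaussianPi n := by
  obtain ⟨c, hc, hcf⟩ := exists_integral_toLp_eq n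
  let w : ℝ → ℝ := fun r => Real.exp (-r ^ 2) / Real.pi ^ Fintype.card n
  have hA : (volume : Measure (EuclideanSpace ℂ n)).toSphere.real Set.univ ≠ 0 := by
    rw [measureReal_def, ENNReal.toReal_ne_zero]
    exact ⟨by simp [-Measure.toSphere_apply_univ], measure_ne_top _ _⟩
  have main : ∀ {f : EuclideanSpace ℂ n → ℝ},
      (∀ r : ℝ, 0 < r → ∀ x, f (r • x) = r ^ m * f x) → _ := fun {f} hf =>
    integral_homogeneous_mul_radial (volume : Measure (EuclideanSpace ℂ n)) hf w
  have h1 : ∀ f : EuclideanSpace ℂ n → ℝ,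
      ∫ z, f (WithLp.toLp 2 z) ∂gaussianPi n = c * ∫ x, f x * w ‖x‖ := by
    intro f
    rw [integral_gaussianPi, ← hcf]
    simp_rw [prod_gaussianDensity]
    rfl
  have hnorm : ∀ r : ℝ, 0 < r → ∀ x : EuclideanSpace ℂ n, ‖r • x‖ ^ m = r ^ m * ‖x‖ ^ m := by
    intro r hr x
    rw [norm_smul, mul_pow, Real.norm_of_nonneg hr.le]
  rw [h1, h1 fun x => ‖x‖ ^ m, main hg, main hnorm, integral_uniformMeasure]
  simp only [norm_eq_of_mem_sphere, one_pow, integral_const, smul_eq_mul, mul_one]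
  field_simp

/-! ### Moments of quadratic forms on the unit sphere -/

theorem integral_sum_sq [Nonempty n] (c : n → ℝ) :
    (Fintype.card n * (Fintype.card n + 1) : ℝ) *
      ∫ ψ : UnitVectors n, (∑ i, c i * ‖ψ.1 i‖ ^ 2) ^ 2 ∂uniformMeasure n =
    (∑ i, c i) ^ 2 + ∑ i, c i ^ 2 := by
  have h := integral_gaussianPi_homogeneous (n := n) (m := 4)
    (g := fun x => (∑ i, c i * ‖x i‖ ^ 2) ^ 2) fun r hr x => by
      simp only [PiLp.smul_apply, norm_smul, mul_pow, Real.norm_eq_abs, sq_abs]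
      simp_rw [mul_left_comm _ (r ^ 2), ← Finset.mul_sum]
      ring
  have h2 := (gaussianPi_moments c Finset.univ).2.2.1
  -- Taking c = 1 gives the radial normalisation: the moment of ‖z‖⁴ is d² + d = d(d+1).
  have h3 := (gaussianPi_moments (fun _ : n => 1) Finset.univ).2.2.1
  have h4 : ∀ z : n → ℂ, ‖(WithLp.toLp 2 z : EuclideanSpace ℂ n)‖ ^ 4 =
      (∑ i, (1 : ℝ) * ‖z i‖ ^ 2) ^ 2 := by
    intro z
    simp only [one_mul]
    rw [show 4 = 2 * 2 from rfl, pow_mul, EuclideanSpace.norm_sq_eq]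
  simp_rw [h4] at h
  rw [h3, h2] at h
  rw [h]
  simp
  ring

theorem integral_sum_pow_four [Nonempty n] (c : n → ℝ) :
    (Fintype.card n * (Fintype.card n + 1) * (Fintype.card n + 2) * (Fintype.card n + 3) : ℝ) *
      ∫ ψ : UnitVectors n, (∑ i, c i * ‖ψ.1 i‖ ^ 2) ^ 4 ∂uniformMeasure n =
    (∑ i, c i) ^ 4 + 6 * (∑ i, c i) ^ 2 * (∑ i, c i ^ 2) +
      3 * (∑ i, c i ^ 2) ^ 2 + 8 * (∑ i, c i) * (∑ i, c i ^ 3) + 6 * ∑ i, c i ^ 4 := by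
  have h := integral_gaussianPi_homogeneous (n := n) (m := 8)
    (g := fun x => (∑ i, c i * ‖x i‖ ^ 2) ^ 4) fun r hr x => by
      simp only [PiLp.smul_apply, norm_smul, mul_pow, Real.norm_eq_abs, sq_abs]
      simp_rw [mul_left_comm _ (r ^ 2), ← Finset.mul_sum]
      ring
  have h2 := (gaussianPi_moments c Finset.univ).2.2.2.2
  -- The same normalisation for ‖z‖⁸: d⁴ + 6d³ + 11d² + 6d = d(d+1)(d+2)(d+3).
  have h3 := (gaussianPi_moments (fun _ : n => 1) Finset.univ).2.2.2.2
  have h4 : ∀ z : n → ℂ, ‖(WithLp.toLp 2 z : EuclideanSpace ℂ n)‖ ^ 8 =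
      (∑ i, (1 : ℝ) * ‖z i‖ ^ 2) ^ 4 := by
    intro z
    simp only [one_mul]
    rw [show 8 = 2 * 4 from rfl, pow_mul, EuclideanSpace.norm_sq_eq]
  simp_rw [h4] at h
  rw [h3, h2] at h
  rw [h]
  simp
  ring

theorem abs_sum_pow_three_le (c : n → ℝ) : |∑ i, c i ^ 3| ≤ √(∑ i, c i ^ 2) ^ 3 := by
  have h0 : 0 ≤ ∑ i, c i ^ 2 := Finset.sum_nonneg fun i _ => sq_nonneg _
  calc |∑ i, c i ^ 3| ≤ ∑ i, |c i ^ 3| := Finset.abs_sum_le_sum_abs _ _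
    _ ≤ ∑ i, √(∑ i, c i ^ 2) * c i ^ 2 := by
      refine Finset.sum_le_sum fun i _ => ?_
      rw [pow_succ', abs_mul, abs_of_nonneg (sq_nonneg (c i))]
      gcongr
      exact Real.abs_le_sqrt (Finset.single_le_sum (f := fun i => c i ^ 2)
        (fun i _ => sq_nonneg _) (Finset.mem_univ i))
    _ = _ := by
      rw [← Finset.mul_sum]
      conv_lhs => rw [← Real.sq_sqrt h0]
      rw [Real.sqrt_sq (Real.sqrt_nonneg _)]
      ring

theorem sum_pow_four_le (c : n → ℝ) : ∑ i, c i ^ 4 ≤ (∑ i, c i ^ 2) ^ 2 := by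
  rw [sq, Finset.sum_mul]
  refine Finset.sum_le_sum fun i _ => ?_
  rw [show c i ^ 4 = c i ^ 2 * c i ^ 2 by ring]
  gcongr
  exact Finset.single_le_sum (f := fun i => c i ^ 2) (fun i _ => sq_nonneg _) (Finset.mem_univ i)

theorem fourth_moment_polynomial_le (c : n → ℝ) :
    (∑ i, c i) ^ 4 + 6 * (∑ i, c i) ^ 2 * (∑ i, c i ^ 2) +
      3 * (∑ i, c i ^ 2) ^ 2 + 8 * (∑ i, c i) * (∑ i, c i ^ 3) + 6 * ∑ i, c i ^ 4 ≤
    12 * ((∑ i, c i) ^ 2 + ∑ i, c i ^ 2) ^ 2 := by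
  have h0 : 0 ≤ ∑ i, c i ^ 2 := Finset.sum_nonneg fun i _ => sq_nonneg _
  have h3 := abs_sum_pow_three_le c
  have h4 := sum_pow_four_le c
  have hb := Real.sq_sqrt h0
  have hb0 := Real.sqrt_nonneg (∑ i, c i ^ 2)
  set b := √(∑ i, c i ^ 2)
  set a := ∑ i, c i
  rw [← hb] at h4 ⊢
  have h5 : a * ∑ i, c i ^ 3 ≤ |a| * b ^ 3 :=
    (le_abs_self _).trans (by rw [abs_mul]; gcongr)
  -- The quadratic 6a² − 8|a|b + 3b² has discriminant 64 − 72 < 0 in |a|. The total is then at most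
  -- a⁴ + 12a²b² + 12b⁴.
  have h6 : 8 * (|a| * b ^ 3) ≤ 6 * a ^ 2 * b ^ 2 + 3 * b ^ 4 := by
    rw [← sq_abs a]
    have : 0 ≤ b ^ 2 * ((2 * |a| - 4 / 3 * b) ^ 2 + 2 * |a| ^ 2 + b ^ 2) := by positivity
    nlinarith [sq_nonneg (b * (4 * |a| - 3 * b)), sq_nonneg (b * |a|), sq_nonneg (b * b)]
  nlinarith [sq_nonneg (a * b), sq_nonneg (a ^ 2)]

end

section

/-! ### Moments of the outcome density of a single system -/

variable {n : Type*} [Fintype n]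

theorem trace_conjTranspose_mul_self (X : Matrix n n ℂ) :
    (Xᴴ * X).trace = ((∑ i, ∑ j, ‖X i j‖ ^ 2 : ℝ) : ℂ) := by
  rw [Finset.sum_comm]
  simp [Matrix.trace, Matrix.mul_apply, Complex.conj_mul']

theorem hsNorm_eq (X : Matrix n n ℂ) : hsNorm X = √(∑ i, ∑ j, ‖X i j‖ ^ 2) := by
  rw [hsNorm, trace_conjTranspose_mul_self, Complex.ofReal_re]

theorem trace_mul_projector (M : Matrix n n ℂ) (ψ : UnitVectors n) :
    (M * projector n ψ).trace = ∑ i, ∑ j, M i j * projector n ψ j i := by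
  simp [Matrix.trace, Matrix.mul_apply]

theorem continuous_trace_mul_projector (M : Matrix n n ℂ) :
    Continuous fun ψ => (M * projector n ψ).trace := by
  simp_rw [trace_mul_projector]
  have := continuous_coord (n := n)
  fun_prop

theorem integrable_of_continuous {X E : Type*} [TopologicalSpace X] [CompactSpace X]
    [MeasurableSpace X] [OpensMeasurableSpace X] [NormedAddCommGroup E]
    [SecondCountableTopologyEither X E] (μ : Measure X)
    [IsFiniteMeasure μ] {f : X → E} (hf : Continuous f) : Integrable f μ :=
  hf.integrable_of_hasCompactSupport (HasCompactSupport.of_compactSpace _)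

theorem integral_comp_sphereMap_eq (e : EuclideanSpace ℂ n ≃ₗᵢ[ℝ] EuclideanSpace ℂ n)
    {g : UnitVectors n → ℝ} (hg : Continuous g) :
    ∫ ψ, g (sphereMap e ψ) ∂uniformMeasure n = ∫ ψ, g ψ ∂uniformMeasure n := by
  have h := measurePreserving_sphereMap e
  conv_rhs => rw [← h.map_eq]
  rw [integral_map h.aemeasurable hg.aestronglyMeasurable]

/-- A Hermitian quadratic form on unit vectors is diagonal in suitable coordinates. -/
theorem exists_diagonalization {M : Matrix n n ℂ} (hM : M.IsHermitian) :
    ∃ (c : n → ℝ) (e : EuclideanSpace ℂ n ≃ₗᵢ[ℝ] EuclideanSpace ℂ n),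
      (∀ ψ, (M * projector n ψ).trace = ((∑ i, c i * ‖(sphereMap e ψ).1 i‖ ^ 2 : ℝ) : ℂ)) ∧
      M.trace = ((∑ i, c i : ℝ) : ℂ) ∧ ∑ i, ∑ j, ‖M i j‖ ^ 2 = ∑ i, c i ^ 2 := by
  classical
  let e' := hM.eigenvectorBasis.repr
  -- The invariance of the uniform measure is formulated for real-linear isometries.
  let e : EuclideanSpace ℂ n ≃ₗᵢ[ℝ] EuclideanSpace ℂ n :=
    { e'.toLinearEquiv.restrictScalars ℝ with norm_map' := e'.norm_map }
  let U : Matrix n n ℂ := hM.eigenvectorUnitary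
  let Λ : Matrix n n ℂ := diagonal fun i => (hM.eigenvalues i : ℂ)
  have hUU : star U * U = 1 := Unitary.coe_star_mul_self _
  have hspec : M = U * Λ * star U := by
    conv_lhs => rw [hM.spectral_theorem, Unitary.conjStarAlgAut_apply]
    rfl
  refine ⟨hM.eigenvalues, e, fun ψ => ?_, ?_, ?_⟩
  · have hv : ∀ i, (sphereMap e ψ).1 i = (star U *ᵥ (ψ : EuclideanSpace ℂ n).ofLp) i := by
      intro i
      change e' ψ.1 i = _
      rw [OrthonormalBasis.repr_apply_apply, EuclideanSpace.inner_eq_star_dotProduct,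
        dotProduct_comm]
      simp [U, Matrix.mulVec, dotProduct]
    conv_lhs => rw [hspec]
    rw [projector, mul_vecMulVec, trace_vecMulVec, ← mulVec_mulVec, ← mulVec_mulVec]
    simp_rw [hv]
    rw [dotProduct_comm, dotProduct_mulVec]
    have : star (ψ : EuclideanSpace ℂ n).ofLp ᵥ* U = star (star U *ᵥ (ψ : EuclideanSpace ℂ n).ofLp) := by
      rw [star_mulVec, star_eq_conjTranspose, conjTranspose_conjTranspose]
    rw [this]
    simp only [Λ, mulVec_diagonal, dotProduct, Pi.star_apply, Complex.ofReal_sum,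
      Complex.ofReal_mul, Complex.ofReal_pow]
    refine Finset.sum_congr rfl fun i _ => ?_
    rw [← Complex.conj_mul', Complex.star_def]
    ring
  · rw [hM.trace_eq_sum_eigenvalues]
    simp
  · have h := trace_conjTranspose_mul_self M
    rw [hM.eq] at h
    have h2 : (M * M).trace = ((∑ i, hM.eigenvalues i ^ 2 : ℝ) : ℂ) := by
      have : M * M = U * (Λ * Λ) * star U := by
        calc M * M = U * Λ * star U * (U * Λ * star U) := by rw [← hspec]
          _ = U * Λ * (star U * U) * (Λ * star U) := by simp only [Matrix.mul_assoc]
          _ = _ := by rw [hUU]; simp only [Matrix.mul_assoc, Matrix.mul_one]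
      rw [this, Matrix.trace_mul_cycle, hUU, Matrix.one_mul]
      simp [Λ, sq]
    rw [h2] at h
    exact_mod_cast h.symm

theorem integral_normSq_trace_of_isHermitian [Nonempty n] {M : Matrix n n ℂ}
    (hM : M.IsHermitian) :
    (Fintype.card n * (Fintype.card n + 1) : ℝ) *
      ∫ ψ, ‖(M * projector n ψ).trace‖ ^ 2 ∂uniformMeasure n =
    ‖M.trace‖ ^ 2 + ∑ i, ∑ j, ‖M i j‖ ^ 2 := by
  obtain ⟨c, e, h1, h2, h3⟩ := exists_diagonalization hM
  simp_rw [h1, h2, h3, Complex.norm_real, Real.norm_eq_abs, sq_abs]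
  rw [← integral_sum_sq, integral_comp_sphereMap_eq e
    (g := fun ψ => (∑ i, c i * ‖ψ.1 i‖ ^ 2) ^ 2) (by fun_prop)]

/-- The dimension quotient is kept rather than bounded by 1: it later turns the factor d(d+1) of the
second moment into at most d². -/
theorem integral_norm_trace_pow_four_le [Nonempty n] {M : Matrix n n ℂ} (hM : M.IsHermitian) :
    ∫ ψ, (‖(M * projector n ψ).trace‖ ^ 2) ^ 2 ∂uniformMeasure n ≤
    12 * (Fintype.card n * (Fintype.card n + 1) / ((Fintype.card n + 2) * (Fintype.card n + 3))) *
      (∫ ψ, ‖(M * projector n ψ).trace‖ ^ 2 ∂uniformMeasure n) ^ 2 := by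
  obtain ⟨c, e, h1, -, -⟩ := exists_diagonalization hM
  simp_rw [h1, Complex.norm_real, Real.norm_eq_abs, sq_abs, ← pow_mul]
  rw [integral_comp_sphereMap_eq e
    (g := fun ψ => (∑ i, c i * ‖ψ.1 i‖ ^ 2) ^ 2) (by fun_prop), integral_comp_sphereMap_eq e
    (g := fun ψ => (∑ i, c i * ‖ψ.1 i‖ ^ 2) ^ (2 * 2)) (by fun_prop)]
  have h2 := integral_sum_sq c
  have h4 := integral_sum_pow_four c
  have hle := fourth_moment_polynomial_le c
  rw [← h4, ← h2] at hle
  have hd : (0 : ℝ) < Fintype.card n := by exact_mod_cast Fintype.card_pos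
  norm_num only
  set d : ℝ := (Fintype.card n : ℝ)
  rw [mul_div_assoc', div_mul_eq_mul_div, le_div_iff₀ (by positivity)]
  refine le_of_mul_le_mul_left ?_ (show 0 < d * (d + 1) by positivity)
  linarith

/-- Write X = H + iK with H, K Hermitian; their forms are real, so all squared moduli add. The
general case is needed because off-diagonal blocks of a Hermitian operator need not be Hermitian. -/
theorem integral_normSq_trace [Nonempty n] (X : Matrix n n ℂ) :
    (Fintype.card n * (Fintype.card n + 1) : ℝ) *
      ∫ ψ, ‖(X * projector n ψ).trace‖ ^ 2 ∂uniformMeasure n =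
    ‖X.trace‖ ^ 2 + ∑ i, ∑ j, ‖X i j‖ ^ 2 := by
  let H : Matrix n n ℂ := (1 / 2 : ℂ) • (X + Xᴴ)
  let K : Matrix n n ℂ := (Complex.I / 2 : ℂ) • (Xᴴ - X)
  have hH : H.IsHermitian := by
    ext i j; simp [H]; ring
  have hK : K.IsHermitian := by
    ext i j; simp [K]; ring
  have hX : X = H + Complex.I • K := by
    ext i j
    simp only [H, K, Matrix.add_apply, Matrix.smul_apply, Matrix.sub_apply, smul_eq_mul]
    linear_combination (-1/2 * (Xᴴ i j - X i j)) * Complex.I_mul_I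
  have hreal : ∀ (M : Matrix n n ℂ), M.IsHermitian → ∀ ψ, ((M * projector n ψ).trace).im = 0 := by
    intro M hM ψ
    obtain ⟨c, e, h1, -, -⟩ := exists_diagonalization hM
    rw [h1, Complex.ofReal_im]
  have htr : ∀ (M : Matrix n n ℂ), M.IsHermitian → M.trace.im = 0 := by
    intro M hM
    obtain ⟨c, e, -, h1, -⟩ := exists_diagonalization hM
    rw [h1, Complex.ofReal_im]
  have hsq : ∀ x y : ℂ, x.im = 0 → y.im = 0 →
      ‖x + Complex.I * y‖ ^ 2 = ‖x‖ ^ 2 + ‖y‖ ^ 2 := by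
    intro x y hx hy
    simp [Complex.sq_norm, Complex.normSq_apply, hx, hy]
  have hpt : ∀ ψ, ‖(X * projector n ψ).trace‖ ^ 2 =
      ‖(H * projector n ψ).trace‖ ^ 2 + ‖(K * projector n ψ).trace‖ ^ 2 := by
    intro ψ
    rw [← hsq _ _ (hreal H hH ψ) (hreal K hK ψ)]
    conv_lhs => rw [hX]
    simp [Matrix.add_mul]
  have hT : ‖X.trace‖ ^ 2 = ‖H.trace‖ ^ 2 + ‖K.trace‖ ^ 2 := by
    rw [← hsq _ _ (htr H hH) (htr K hK)]
    conv_lhs => rw [hX]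
    simp
  have hS : ∑ i, ∑ j, ‖X i j‖ ^ 2 = ∑ i, ∑ j, ‖H i j‖ ^ 2 + ∑ i, ∑ j, ‖K i j‖ ^ 2 := by
    have hij : ∀ i j, ‖H i j‖ ^ 2 + ‖K i j‖ ^ 2 = (‖X i j‖ ^ 2 + ‖X j i‖ ^ 2) / 2 := by
      intro i j
      simp only [H, K, Matrix.add_apply, Matrix.smul_apply, Matrix.sub_apply, conjTranspose_apply,
        Complex.sq_norm, Complex.normSq_apply]
      simp
      ring
    simp_rw [← Finset.sum_add_distrib, hij, ← Finset.sum_div, Finset.sum_add_distrib]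
    rw [Finset.sum_comm (f := fun i j => ‖X j i‖ ^ 2)]
    ring
  have hi : ∀ M : Matrix n n ℂ, Integrable (fun ψ => ‖(M * projector n ψ).trace‖ ^ 2)
      (uniformMeasure n) := fun M =>
    integrable_of_continuous _ ((continuous_trace_mul_projector M).norm.pow 2)
  simp_rw [hpt]
  rw [integral_add (hi H) (hi K), mul_add, integral_normSq_trace_of_isHermitian hH,
    integral_normSq_trace_of_isHermitian hK, hT, hS]
  ring

end

/-! ### The fourth moment method -/

section FourthMoment

variable {X Y : Type*} [MeasurableSpace X] [MeasurableSpace Y]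

theorem integral_mul_le_sqrt_mul_sqrt {μ : Measure X} {f g : X → ℝ} (hf0 : ∀ x, 0 ≤ f x)
    (hg0 : ∀ x, 0 ≤ g x) (hf : MemLp f 2 μ) (hg : MemLp g 2 μ) :
    ∫ x, f x * g x ∂μ ≤ √(∫ x, f x ^ 2 ∂μ) * √(∫ x, g x ^ 2 ∂μ) := by
  have h := integral_mul_le_Lp_mul_Lq_of_nonneg (μ := μ) Real.HolderConjugate.two_two
    (.of_forall hf0) (.of_forall hg0) (by simpa using hf) (by simpa using hg)
  simpa [Real.sqrt_eq_rpow] using h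

/-- `S³ ≤ L² F` for the absolute, second and fourth moments `L`, `S`, `F`. -/
theorem integral_sq_pow_three_le {μ : Measure X} {f : X → ℝ}
    (h1 : Integrable f μ) (h2 : Integrable (fun x => f x ^ 2) μ)
    (h4 : Integrable (fun x => (f x ^ 2) ^ 2) μ) (hf0 : ∀ x, 0 ≤ f x) :
    (∫ x, f x ^ 2 ∂μ) ^ 3 ≤ (∫ x, f x ∂μ) ^ 2 * ∫ x, (f x ^ 2) ^ 2 ∂μ := by
  have hL : 0 ≤ ∫ x, f x ∂μ := integral_nonneg hf0
  have hS : 0 ≤ ∫ x, f x ^ 2 ∂μ := integral_nonneg fun x => sq_nonneg _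
  have hF : 0 ≤ ∫ x, (f x ^ 2) ^ 2 ∂μ := integral_nonneg fun x => sq_nonneg _
  -- Integrate f(f − a)²(f + 2a) = f⁴ − 3a²f² + 2a³f ≥ 0.
  have key : ∀ a : ℝ, 0 ≤ a → 3 * a ^ 2 * ∫ x, f x ^ 2 ∂μ ≤
      2 * a ^ 3 * ∫ x, f x ∂μ + ∫ x, (f x ^ 2) ^ 2 ∂μ := by
    intro a ha
    rw [← integral_const_mul, ← integral_const_mul, ← integral_add (h1.const_mul _) h4]
    refine integral_mono (h2.const_mul _) ((h1.const_mul _).add h4) fun x => ?_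
    have : 0 ≤ f x * (f x - a) ^ 2 * (f x + 2 * a) := by
      have := hf0 x
      positivity
    simp only
    linarith
  set L := ∫ x, f x ∂μ
  set S := ∫ x, f x ^ 2 ∂μ
  set F := ∫ x, (f x ^ 2) ^ 2 ∂μ
  rcases hS.eq_or_lt with hS0 | hS0
  · have : 0 ≤ L ^ 2 * F := by positivity
    simpa [← hS0] using this
  -- With a² = F/S the inequality reduces to S ≤ aL, whose square is the claim.
  have h := key (√(F / S)) (Real.sqrt_nonneg _)
  have hsq := Real.sq_sqrt (show 0 ≤ F / S by positivity)
  set a := √(F / S)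
  have ha : 0 ≤ a := Real.sqrt_nonneg _
  have hF' : F = a ^ 2 * S := by rw [hsq]; field_simp
  rw [hF'] at h ⊢
  rcases ha.eq_or_lt with ha0 | ha0
  -- Here F = 0 < S. Then 3S ≤ 2tL for all small t > 0, which fails at t = min(1, S/L).
  · have h5 := key 1 zero_le_one
    have h6 : ∀ t : ℝ, 0 < t → t ≤ 1 → 3 * S ≤ 2 * t * L := by
      intro t ht _
      have := key t ht.le
      rw [hF', ← ha0] at this
      refine le_of_mul_le_mul_left ?_ (show 0 < t ^ 2 by positivity)
      linarith
    exfalso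
    have hLp : 0 < L := by
      have := h6 1 one_pos le_rfl
      linarith
    have := h6 (min 1 (S / L)) (by positivity) (min_le_left _ _)
    have h7 : min 1 (S / L) * L ≤ S := by
      calc _ ≤ S / L * L := by gcongr; exact min_le_right _ _
        _ = S := by field_simp
    linarith
  · have h8 : S ≤ a * L := by
      refine le_of_mul_le_mul_left ?_ (show 0 < 2 * a ^ 2 by positivity)
      linarith
    have h9 : S ^ 2 ≤ (a * L) ^ 2 := by gcongr
    calc S ^ 3 = S ^ 2 * S := by ring
      _ ≤ (a * L) ^ 2 * S := by gcongr
      _ = _ := by ring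

variable [TopologicalSpace X] [CompactSpace X] [BorelSpace X] [SecondCountableTopology X]
  [T2Space X] [TopologicalSpace Y] [CompactSpace Y] [BorelSpace Y] [SecondCountableTopology Y]
  [T2Space Y]

theorem continuous_integral_of_continuous {Z : Type*} [TopologicalSpace Z]
    [FirstCountableTopology Z] [LocallyCompactSpace Z] (ν : Measure Y) [IsFiniteMeasure ν]
    {h : Z × Y → ℝ}
    (hc : Continuous h) : Continuous fun x => ∫ y, h (x, y) ∂ν := by
  have := continuous_parametric_integral_of_continuous (μ := ν) (f := fun x y => h (x, y)) hc
    isCompact_univ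
  simpa using this

/-- Reverse Hölder constants of second order multiply over products. -/
theorem integral_prod_sq_le {μ : Measure X} [IsFiniteMeasure μ] {ν : Measure Y}
    [IsFiniteMeasure ν] {h : X × Y → ℝ} (hc : Continuous h) (h0 : ∀ z, 0 ≤ h z) {K K' : ℝ}
    (hK0 : 0 ≤ K) (hK0' : 0 ≤ K')
    (hK : ∀ x, ∫ y, h (x, y) ^ 2 ∂ν ≤ K * (∫ y, h (x, y) ∂ν) ^ 2)
    (hK' : ∀ y, ∫ x, h (x, y) ^ 2 ∂μ ≤ K' * (∫ x, h (x, y) ∂μ) ^ 2) :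
    ∫ z, h z ^ 2 ∂μ.prod ν ≤ K * K' * (∫ z, h z ∂μ.prod ν) ^ 2 := by
  have hi : ∀ {f : X × Y → ℝ}, Continuous f → Integrable f (μ.prod ν) := fun hf =>
    integrable_of_continuous _ hf
  rw [integral_prod (fun z => h z ^ 2) (hi (hc.pow 2))]
  let g : X → ℝ := fun x => ∫ y, h (x, y) ∂ν
  have hg : Continuous g := continuous_integral_of_continuous ν hc
  have hg0 : ∀ x, 0 ≤ g x := fun x => integral_nonneg fun y => h0 _
  have hS0 : 0 ≤ ∫ z, h z ∂μ.prod ν := integral_nonneg h0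
  have hG0 : 0 ≤ ∫ x, g x ^ 2 ∂μ := integral_nonneg fun x => sq_nonneg _
  have hL2 : ∀ {f : X → ℝ}, Continuous f → MemLp f 2 μ := fun {f} hf =>
    (memLp_two_iff_integrable_sq hf.aestronglyMeasurable).2 (integrable_of_continuous _ (hf.pow 2))
  have h1 : ∫ x, ∫ y, h (x, y) ^ 2 ∂ν ∂μ ≤ K * ∫ x, g x ^ 2 ∂μ := by
    rw [← integral_const_mul]
    exact integral_mono
      (integrable_of_continuous _ (continuous_integral_of_continuous ν (hc.pow 2)))
      ((integrable_of_continuous _ (hg.pow 2)).const_mul _) hK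
  -- Minkowski's inequality ‖∫ h(·,y)‖₂ ≤ ∫ ‖h(·,y)‖₂ by duality: test against `g` itself and apply
  -- Cauchy–Schwarz in x for each y.
  have h2 : ∫ x, g x ^ 2 ∂μ ≤
      √(∫ x, g x ^ 2 ∂μ) * (√K' * ∫ z, h z ∂μ.prod ν) := by
    calc ∫ x, g x ^ 2 ∂μ = ∫ x, ∫ y, g x * h (x, y) ∂ν ∂μ := by
          simp_rw [integral_const_mul, sq]
          rfl
      _ = ∫ y, ∫ x, g x * h (x, y) ∂μ ∂ν :=
          integral_integral_swap (hi ((hg.comp continuous_fst).mul hc))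
      _ ≤ ∫ y, √(∫ x, g x ^ 2 ∂μ) * (√K' * ∫ x, h (x, y) ∂μ) ∂ν := by
          have hsw : Continuous fun p : Y × X => h (p.2, p.1) := by fun_prop
          refine integral_mono (integrable_of_continuous _
            (continuous_integral_of_continuous μ (h := fun p : Y × X => g p.2 * h (p.2, p.1))
              (by fun_prop)))
            (integrable_of_continuous _ (((continuous_integral_of_continuous μ hsw).const_mul
              _).const_mul _)) fun y => ?_
          refine (integral_mul_le_sqrt_mul_sqrt hg0 (fun x => h0 (x, y)) (hL2 hg)
            (hL2 (by fun_prop))).trans ?_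
          gcongr
          refine Real.sqrt_le_iff.2 ⟨mul_nonneg (Real.sqrt_nonneg _)
            (integral_nonneg fun x => h0 _), (hK' y).trans ?_⟩
          rw [mul_pow, Real.sq_sqrt hK0']
      _ = _ := by
          rw [integral_const_mul, integral_const_mul, integral_prod_symm _ (hi hc)]
  have h3 : ∫ x, g x ^ 2 ∂μ ≤ K' * (∫ z, h z ∂μ.prod ν) ^ 2 := by
    have hs := Real.sq_sqrt hG0
    have ht := Real.sq_sqrt hK0'
    have hs0 := Real.sqrt_nonneg (∫ x, g x ^ 2 ∂μ)
    have ht0 := Real.sqrt_nonneg K'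
    set G := ∫ x, g x ^ 2 ∂μ
    set s := √G
    have : s ≤ √K' * ∫ z, h z ∂μ.prod ν := by
      rcases hs0.eq_or_lt with h00 | h00
      · rw [← h00]; positivity
      · rw [← hs, sq] at h2
        exact le_of_mul_le_mul_left h2 h00
    rw [← hs]
    nth_rewrite 1 [← ht]
    rw [← mul_pow]
    gcongr
  calc _ ≤ K * ∫ x, g x ^ 2 ∂μ := h1
    _ ≤ K * (K' * (∫ z, h z ∂μ.prod ν) ^ 2) := by gcongr
    _ = _ := by ring

end FourthMoment

/-! ### Trace norm -/

section TraceNorm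

variable {n : Type*} [Fintype n] [DecidableEq n]

/-- The eigenvalues of X†X are nonnegative, so `Real.sqrt` is a genuine square root on its spectrum.
-/
theorem posSemidef_cfc_sqrt (X : Matrix n n ℂ) :
    (cfc Real.sqrt (Xᴴ * X)).PosSemidef ∧
      cfc Real.sqrt (Xᴴ * X) * cfc Real.sqrt (Xᴴ * X) = Xᴴ * X := by
  have hA : (Xᴴ * X).IsHermitian := isHermitian_conjTranspose_mul_self X
  have hP := posSemidef_conjTranspose_mul_self X
  constructor
  · rw [hA.cfc_eq, Matrix.IsHermitian.cfc, Unitary.conjStarAlgAut_apply, star_eq_conjTranspose]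
    refine PosSemidef.mul_mul_conjTranspose_same (PosSemidef.diagonal fun i => ?_) _
    simp [Real.sqrt_nonneg]
  · have hsa : IsSelfAdjoint (Xᴴ * X) := hA
    rw [← cfc_mul Real.sqrt Real.sqrt (Xᴴ * X) (by fun_prop) (by fun_prop)]
    conv_rhs => rw [← cfc_id ℝ (Xᴴ * X)]
    refine cfc_congr fun x hx => ?_
    rw [hA.spectrum_real_eq_range_eigenvalues] at hx
    obtain ⟨i, rfl⟩ := hx
    simpa using Real.mul_self_sqrt (hP.eigenvalues_nonneg i)

theorem traceNorm_nonneg (X : Matrix n n ℂ) : 0 ≤ traceNorm X := by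
  have := (posSemidef_cfc_sqrt X).1.trace_nonneg
  exact (Complex.le_def.1 this).1

theorem traceNorm_pos {X : Matrix n n ℂ} (hX : X ≠ 0) : 0 < traceNorm X := by
  refine (traceNorm_nonneg X).lt_of_ne fun h => hX ?_
  obtain ⟨hP, hPP⟩ := posSemidef_cfc_sqrt X
  have h0 : (cfc Real.sqrt (Xᴴ * X)).trace = 0 := by
    refine Complex.ext h.symm ?_
    exact (Complex.le_def.1 hP.trace_nonneg).2.symm
  rw [hP.trace_eq_zero_iff.1 h0, Matrix.mul_zero] at hPP
  exact conjTranspose_mul_self_eq_zero.1 hPP.symm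

/-- `‖X‖₁ ≤ √d ‖X‖₂`. -/
theorem traceNorm_le (X : Matrix n n ℂ) : traceNorm X ≤ √(Fintype.card n) * hsNorm X := by
  obtain ⟨hP, hPP⟩ := posSemidef_cfc_sqrt X
  rw [traceNorm, hsNorm]
  set P := cfc Real.sqrt (Xᴴ * X)
  rw [← hPP]
  have h1 := trace_conjTranspose_mul_self P
  rw [hP.isHermitian.eq] at h1
  rw [h1, Complex.ofReal_re, ← Real.sqrt_mul (Nat.cast_nonneg _)]
  refine Real.le_sqrt_of_sq_le ?_
  rw [Matrix.trace, Complex.re_sum]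
  -- Cauchy–Schwarz on the diagonal of P = |X|; its squared diagonal entries sum to at most ∑ |Pᵢⱼ|²
  -- = tr P².
  refine sq_sum_le_card_mul_sum_sq.trans ?_
  rw [Finset.card_univ]
  gcongr with i
  calc ((P.diag i).re) ^ 2 ≤ ‖P i i‖ ^ 2 := by
        rw [← sq_abs]
        gcongr
        exact Complex.abs_re_le_norm _
    _ ≤ _ := Finset.single_le_sum (f := fun j => ‖P i j‖ ^ 2) (fun _ _ => sq_nonneg _)
        (Finset.mem_univ i)

end TraceNorm

/-! ### Tensor products of isotropic POVMs -/

section Bipartite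

variable {a b : Type*} [Fintype a] [Fintype b]

/-- The block `⟨k|ξ|l⟩` of an operator on a tensor product. -/
def block (ξ : Matrix (a × b) (a × b) ℂ) (k l : b) : Matrix a a ℂ :=
  of fun i j => ξ (i, k) (j, l)

/-- The operator `⟨φ|ξ|φ⟩` on the second factor. -/
def slice (ξ : Matrix (a × b) (a × b) ℂ) (φ : UnitVectors a) : Matrix b b ℂ :=
  of fun k l => (block ξ k l * projector a φ).trace

/-- With φ fixed, the bipartite form is a single-system form in ψ. -/
theorem trace_mul_kronecker_projector (ξ : Matrix (a × b) (a × b) ℂ) (φ : UnitVectors a)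
    (ψ : UnitVectors b) :
    (ξ * (projector a φ ⊗ₖ projector b ψ)).trace = (slice ξ φ * projector b ψ).trace := by
  rw [trace_mul_projector]
  simp only [slice, of_apply, block, Matrix.trace, Matrix.mul_apply,
    Matrix.diag_apply, kroneckerMap_apply, Fintype.sum_prod_type, Finset.sum_mul]
  rw [Finset.sum_comm]
  refine Finset.sum_congr rfl fun k _ => ?_
  rw [Finset.sum_congr rfl fun i _ => Finset.sum_comm, Finset.sum_comm]
  refine Finset.sum_congr rfl fun l _ => Finset.sum_congr rfl fun i _ =>
    Finset.sum_congr rfl fun j _ => ?_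
  ring

theorem trace_mul_kronecker_projector_swap (ξ : Matrix (a × b) (a × b) ℂ) (φ : UnitVectors a)
    (ψ : UnitVectors b) :
    (ξ * (projector a φ ⊗ₖ projector b ψ)).trace =
      (slice (ξ.submatrix Prod.swap Prod.swap) ψ * projector a φ).trace := by
  rw [← trace_mul_kronecker_projector]
  simp only [Matrix.trace, Matrix.mul_apply, Matrix.diag_apply, kroneckerMap_apply,
    submatrix_apply]
  rw [← Equiv.sum_comp (Equiv.prodComm b a)]
  refine Finset.sum_congr rfl fun x _ => ?_
  rw [← Equiv.sum_comp (Equiv.prodComm b a)]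
  refine Finset.sum_congr rfl fun y _ => ?_
  simp only [Equiv.prodComm_apply, Prod.fst_swap, Prod.snd_swap]
  ring

theorem isHermitian_projector (φ : UnitVectors a) : (projector a φ).IsHermitian := by
  ext i j
  simp [projector, vecMulVec_apply, mul_comm]

theorem isHermitian_slice {c : Type*} {ξ : Matrix (a × c) (a × c) ℂ} (hξ : ξ.IsHermitian)
    (φ : UnitVectors a) : (slice ξ φ).IsHermitian := by
  ext k l
  have h : (block ξ l k)ᴴ = block ξ k l := by
    ext i j
    exact hξ.apply _ _
  simp only [slice, conjTranspose_apply, of_apply]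
  rw [← trace_conjTranspose, conjTranspose_mul, (isHermitian_projector φ).eq, h,
    Matrix.trace_mul_comm]

theorem continuous_trace_mul_kronecker_projector (ξ : Matrix (a × b) (a × b) ℂ) :
    Continuous fun z : UnitVectors a × UnitVectors b =>
      (ξ * (projector a z.1 ⊗ₖ projector b z.2)).trace := by
  simp only [Matrix.trace, Matrix.mul_apply, Matrix.diag_apply, kroneckerMap_apply]
  have h1 := fun i j => (continuous_coord (n := a) i j).comp
    (continuous_fst (X := UnitVectors a) (Y := UnitVectors b))
  have h2 := fun i j => (continuous_coord (n := b) i j).comp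
    (continuous_snd (X := UnitVectors a) (Y := UnitVectors b))
  simp only [Function.comp_def] at h1 h2
  exact continuous_finsetSum _ fun x _ => continuous_finsetSum _ fun y _ =>
    continuous_const.mul ((h1 _ _).mul (h2 _ _))

/-- Apply the exact second moment over ψ to the slice, then over φ to each of its entries, which are
forms given by the blocks. The trace terms are nonnegative and are dropped. -/
theorem sum_normSq_le_integral [Nonempty a] [Nonempty b] (ξ : Matrix (a × b) (a × b) ℂ) :
    ∑ x, ∑ y, ‖ξ x y‖ ^ 2 ≤
      (Fintype.card a * (Fintype.card a + 1)) * (Fintype.card b * (Fintype.card b + 1)) *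
      ∫ z, ‖(ξ * (projector a z.1 ⊗ₖ projector b z.2)).trace‖ ^ 2
        ∂(uniformMeasure a).prod (uniformMeasure b) := by
  have hc := (continuous_trace_mul_kronecker_projector ξ).norm.pow 2
  rw [mul_assoc, integral_prod (fun z : UnitVectors a × UnitVectors b =>
      ‖(ξ * (projector a z.1 ⊗ₖ projector b z.2)).trace‖ ^ 2) (integrable_of_continuous _ hc),
    ← integral_const_mul]
  simp_rw [trace_mul_kronecker_projector, integral_normSq_trace]
  have hi : ∀ k l, Integrable (fun φ => ‖slice ξ φ k l‖ ^ 2) (uniformMeasure a) := fun k l =>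
    integrable_of_continuous _ ((continuous_trace_mul_projector (block ξ k l)).norm.pow 2)
  have hi2 : Integrable (fun φ => ∑ k, ∑ l, ‖slice ξ φ k l‖ ^ 2) (uniformMeasure a) :=
    integrable_finsetSum _ fun k _ => integrable_finsetSum _ fun l _ => hi k l
  have hi3 : Integrable (fun φ => ‖(slice ξ φ).trace‖ ^ 2) (uniformMeasure a) := by
    refine integrable_of_continuous _ ((continuous_finsetSum _ fun k _ => ?_).norm.pow 2)
    exact continuous_trace_mul_projector (block ξ k k)
  rw [integral_add hi3 hi2, mul_add]
  refine le_add_of_nonneg_of_le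
    (mul_nonneg (by positivity) (integral_nonneg fun φ => sq_nonneg _)) ?_
  rw [integral_finsetSum _ fun k _ => integrable_finsetSum _ fun l _ => hi k l]
  simp_rw [integral_finsetSum _ fun l _ => hi _ l, Finset.mul_sum]
  simp only [slice, of_apply, integral_normSq_trace]
  calc ∑ x, ∑ y, ‖ξ x y‖ ^ 2 = ∑ k, ∑ l, ∑ i, ∑ j, ‖block ξ k l i j‖ ^ 2 := by
        simp only [Fintype.sum_prod_type, block, of_apply]
        rw [Finset.sum_comm]
        refine Finset.sum_congr rfl fun k _ => ?_
        rw [Finset.sum_comm (s := (Finset.univ : Finset b)) (t := (Finset.univ : Finset a))]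
        refine Finset.sum_congr rfl fun i _ => ?_
        rw [Finset.sum_comm]
    _ ≤ _ := Finset.sum_le_sum fun k _ => Finset.sum_le_sum fun l _ =>
        le_add_of_nonneg_left (sq_nonneg _)

/-- Slices in either direction are Hermitian, so the one-system bound holds in each variable and the
constants multiply. -/
theorem integral_prod_pow_four_le [Nonempty a] [Nonempty b] {ξ : Matrix (a × b) (a × b) ℂ}
    (hξ : ξ.IsHermitian) :
    ∫ z, (‖(ξ * (projector a z.1 ⊗ₖ projector b z.2)).trace‖ ^ 2) ^ 2
        ∂(uniformMeasure a).prod (uniformMeasure b) ≤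
      (12 * (Fintype.card b * (Fintype.card b + 1) /
        ((Fintype.card b + 2) * (Fintype.card b + 3)))) *
      (12 * (Fintype.card a * (Fintype.card a + 1) /
        ((Fintype.card a + 2) * (Fintype.card a + 3)))) *
      (∫ z, ‖(ξ * (projector a z.1 ⊗ₖ projector b z.2)).trace‖ ^ 2
        ∂(uniformMeasure a).prod (uniformMeasure b)) ^ 2 := by
  let h : UnitVectors a × UnitVectors b → ℝ := fun z =>
    ‖(ξ * (projector a z.1 ⊗ₖ projector b z.2)).trace‖ ^ 2
  have hc : Continuous h := (continuous_trace_mul_kronecker_projector ξ).norm.pow 2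
  have hA : ∀ φ, (fun ψ => h (φ, ψ)) = fun ψ => ‖(slice ξ φ * projector b ψ).trace‖ ^ 2 :=
    fun φ => funext fun ψ => by simp only [h, trace_mul_kronecker_projector]
  have hB : ∀ ψ, (fun φ => h (φ, ψ)) =
      fun φ => ‖(slice (ξ.submatrix Prod.swap Prod.swap) ψ * projector a φ).trace‖ ^ 2 :=
    fun ψ => funext fun φ => by simp only [h, trace_mul_kronecker_projector_swap]
  refine integral_prod_sq_le hc (fun z => sq_nonneg _) ?_ ?_ (fun φ => ?_) (fun ψ => ?_)
  · positivity
  · positivity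
  · simp only [congrFun (hA φ)]
    exact integral_norm_trace_pow_four_le (isHermitian_slice hξ φ)
  · simp only [congrFun (hB ψ)]
    exact integral_norm_trace_pow_four_le (isHermitian_slice (hξ.submatrix _) ψ)

variable [DecidableEq a] [DecidableEq b]

theorem norm_tensor_isotropicPOVM (ξ : Matrix (a × b) (a × b) ℂ) :
    ((isotropicPOVM a).tensor (isotropicPOVM b)).norm ξ =
      Fintype.card a * Fintype.card b *
        ∫ z, ‖(ξ * (projector a z.1 ⊗ₖ projector b z.2)).trace‖
          ∂(uniformMeasure a).prod (uniformMeasure b) := by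
  rw [← integral_const_mul]
  refine integral_congr_ae (.of_forall fun z => ?_)
  simp [POVM.output, POVM.tensor, isotropicPOVM, smul_kronecker, kronecker_smul, mul_assoc]
  exact mul_left_comm _ _ _

/-- The norm of the tensor product of isotropic POVMs dominates the Hilbert-Schmidt norm. -/
theorem hsNorm_le_norm_tensor [Nonempty a] [Nonempty b] {ξ : Matrix (a × b) (a × b) ℂ}
    (hξ : ξ.IsHermitian) :
    hsNorm ξ ≤ 12 * ((isotropicPOVM a).tensor (isotropicPOVM b)).norm ξ := by
  have hc := (continuous_trace_mul_kronecker_projector ξ).norm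
  have h1 := sum_normSq_le_integral ξ
  have h2 := integral_prod_pow_four_le hξ
  have h3 := integral_sq_pow_three_le (μ := (uniformMeasure a).prod (uniformMeasure b))
    (integrable_of_continuous _ hc) (integrable_of_continuous _ (hc.pow 2))
    (integrable_of_continuous _ ((hc.pow 2).pow 2)) fun z => norm_nonneg _
  have hS : 0 ≤ ∫ z, ‖(ξ * (projector a z.1 ⊗ₖ projector b z.2)).trace‖ ^ 2
      ∂(uniformMeasure a).prod (uniformMeasure b) := integral_nonneg fun z => sq_nonneg _
  have hL : 0 ≤ ∫ z, ‖(ξ * (projector a z.1 ⊗ₖ projector b z.2)).trace‖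
      ∂(uniformMeasure a).prod (uniformMeasure b) := integral_nonneg fun z => norm_nonneg _
  have ha : (0 : ℝ) < Fintype.card a := by exact_mod_cast Fintype.card_pos
  have hb : (0 : ℝ) < Fintype.card b := by exact_mod_cast Fintype.card_pos
  rw [hsNorm_eq, norm_tensor_isotropicPOVM]
  refine Real.sqrt_le_iff.2 ⟨by positivity, h1.trans ?_⟩
  set S := ∫ z, ‖(ξ * (projector a z.1 ⊗ₖ projector b z.2)).trace‖ ^ 2
      ∂(uniformMeasure a).prod (uniformMeasure b)
  set L := ∫ z, ‖(ξ * (projector a z.1 ⊗ₖ projector b z.2)).trace‖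
      ∂(uniformMeasure a).prod (uniformMeasure b)
  set p := (Fintype.card a : ℝ)
  set q := (Fintype.card b : ℝ)
  rcases hS.eq_or_lt with hS0 | hS0
  · rw [← hS0, mul_zero]; positivity
  have h4 : S ≤ L ^ 2 * ((12 * (q * (q + 1) / ((q + 2) * (q + 3)))) *
      (12 * (p * (p + 1) / ((p + 2) * (p + 3))))) := by
    refine le_of_mul_le_mul_right ?_ (show 0 < S ^ 2 by positivity)
    calc S * S ^ 2 = S ^ 3 := by ring
      _ ≤ _ := h3
      _ ≤ L ^ 2 * _ := mul_le_mul_of_nonneg_left h2 (sq_nonneg L)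
      _ = _ := by ring
  -- After clearing denominators this is (d+1)² ≤ (d+2)(d+3).
  have hd : ∀ d : ℝ, 0 < d → (d * (d + 1)) * (d * (d + 1) / ((d + 2) * (d + 3))) ≤ d ^ 2 := by
    intro d hd
    rw [mul_div_assoc', div_le_iff₀ (by positivity)]
    have : 0 ≤ d ^ 2 * (3 * d + 5) := by positivity
    linarith
  calc (p * (p + 1)) * (q * (q + 1)) * S
      ≤ (p * (p + 1)) * (q * (q + 1)) * (L ^ 2 * ((12 * (q * (q + 1) / ((q + 2) * (q + 3)))) *
      (12 * (p * (p + 1) / ((p + 2) * (p + 3)))))) := by gcongr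
    _ = 144 * L ^ 2 * (((p * (p + 1)) * (p * (p + 1) / ((p + 2) * (p + 3)))) *
        ((q * (q + 1)) * (q * (q + 1) / ((q + 2) * (q + 3))))) := by ring
    _ ≤ 144 * L ^ 2 * (p ^ 2 * q ^ 2) := by
        have := hd p ha
        have := hd q hb
        gcongr
    _ = _ := by ring

end Bipartite

/-! ### The constant of domination -/

/-- The set is an intersection of closed conditions and contains 0. The operator |i⟩⟨i| − |j⟩⟨j|
with i ≠ j has positive trace norm and bounds the set above; this is where dimension at least 2
enters. -/
theorem POVM.isGreatest_domination {Ω : Type*} [MeasurableSpace Ω] {n : Type*} [Fintype n]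
    [DecidableEq n] [Nontrivial n] (M : POVM Ω n) : IsGreatest M.dominationSet M.domination := by
  have hclosed : IsClosed M.dominationSet := by
    simp only [POVM.dominationSet, Set.ofPred_forall]
    refine isClosed_iInter fun ξ => isClosed_iInter fun _ => isClosed_iInter fun _ => ?_
    exact isClosed_le (by fun_prop) continuous_const
  have hne : M.dominationSet.Nonempty :=
    ⟨0, fun ξ _ _ => by rw [zero_mul]; exact integral_nonneg fun x => norm_nonneg _⟩
  have hbdd : BddAbove M.dominationSet := by
    obtain ⟨i, j, hij⟩ := exists_pair_ne n
    let ξ : Matrix n n ℂ := diagonal (Pi.single i 1 - Pi.single j 1)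
    have h1 : ξ.IsHermitian := by
      rw [Matrix.IsHermitian, diagonal_conjTranspose]
      congr 1
      ext k
      simp only [Pi.star_apply, Pi.sub_apply, Pi.single_apply]
      split_ifs <;> simp
    have h2 : ξ.trace = 0 := by simp [ξ, trace_diagonal]
    have h3 : ξ ≠ 0 := by
      intro h
      have := congrFun (congrFun h i) i
      simp [ξ, hij] at this
    refine ⟨M.norm ξ / traceNorm ξ, fun l hl => ?_⟩
    rw [le_div_iff₀ (traceNorm_pos h3)]
    exact hl ξ h1 h2
  exact ⟨hclosed.csSup_mem hne hbdd, fun l hl => le_csSup hbdd hl⟩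

end QMeas

end

theorem mainTheorem1 {a b : Type*} [Fintype a] [DecidableEq a] [Fintype b] [DecidableEq b]
    (D : ℕ) (hD : D = Fintype.card a * Fintype.card b)
    (U : QMeas.POVM (QMeas.UnitVectors a × QMeas.UnitVectors b) (a × b))
    (hU : U = (QMeas.isotropicPOVM a).tensor (QMeas.isotropicPOVM b)) :
    (∀ ρ σ : Matrix (a × b) (a × b) ℂ, QMeas.IsState ρ → QMeas.IsState σ →
      U.norm (ρ - σ) ≥ 1 / √153 * QMeas.hsNorm (ρ - σ) ∧
      1 / √153 * QMeas.hsNorm (ρ - σ) ≥ 1 / √(153 * D) * QMeas.traceNorm (ρ - σ)) ∧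
    (2 ≤ D → IsGreatest U.dominationSet U.domination ∧ U.domination ≥ 1 / √(153 * D)) := by
  -- The fourth moment argument gives the constant 1/12, slightly better than 1/√153.
  have h12 : (12 : ℝ) ≤ √153 := Real.le_sqrt_of_sq_le (by norm_num)
  have hcard : Fintype.card (a × b) = D := by rw [Fintype.card_prod, hD]
  have hhs : ∀ ξ : Matrix (a × b) (a × b) ℂ, 0 ≤ QMeas.hsNorm ξ := fun ξ => Real.sqrt_nonneg _
  have first : 0 < D → ∀ ξ : Matrix (a × b) (a × b) ℂ, ξ.IsHermitian →
      1 / √153 * QMeas.hsNorm ξ ≤ U.norm ξ := by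
    intro hD0 ξ hξ
    have : Nonempty (a × b) := Fintype.card_pos_iff.1 (by omega)
    obtain ⟨ha, hb⟩ := nonempty_prod.1 this
    have h := QMeas.hsNorm_le_norm_tensor hξ
    rw [← hU] at h
    have h0 := (hhs ξ).trans h
    rw [one_div, inv_mul_le_iff₀ (by positivity)]
    exact h.trans (by gcongr; linarith)
  have second : 0 < D → ∀ ξ : Matrix (a × b) (a × b) ℂ,
      1 / √(153 * D) * QMeas.traceNorm ξ ≤ 1 / √153 * QMeas.hsNorm ξ := by
    intro hD0 ξ
    have h := QMeas.traceNorm_le ξ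
    rw [hcard] at h
    have hDpos : (0 : ℝ) < √D := Real.sqrt_pos.2 (by exact_mod_cast hD0)
    rw [Real.sqrt_mul (by norm_num), one_div, mul_inv, mul_assoc, ← one_div √153]
    gcongr
    rwa [inv_mul_le_iff₀ hDpos]
  refine ⟨fun ρ σ hρ hσ => ?_, fun hD2 => ?_⟩
  -- In dimension zero every trace vanishes, so there are no states.
  · have hD0 : 0 < D := by
      rcases Nat.eq_zero_or_pos D with h | h
      · have : IsEmpty (a × b) := Fintype.card_eq_zero_iff.1 (by omega)
        have h1 := hρ.2
        simp [Matrix.trace] at h1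
      · exact h
    exact ⟨first hD0 _ (hρ.1.isHermitian.sub hσ.1.isHermitian), second hD0 _⟩
  · have : Nontrivial (a × b) := Fintype.one_lt_card_iff_nontrivial.1 (by omega)
    have hg := U.isGreatest_domination
    refine ⟨hg, hg.2 fun ξ hξ _ => ?_⟩
    exact (second (by omega) ξ).trans (first (by omega) ξ hξ)
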